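/- Let $f:\mathbb{C}^2\to\mathbb{C}^2$ be the quadratic family $f(z,\lambda)=(z^2+\lambda,\lambda)$, and let $f^n$ denote its $n$-th iterate. A vertical line is a set $\{\lambda=c\}$ and a horizontal line is a set $\{z=c\}$, with $c\in\mathbb{C}$. An algebraic curve in $\mathbb{C}^2$ is the zero set of a nonconstant polynomial in $\mathbb{C}[z,\lambda]$ (not necessarily irreducible), and its degree $\deg$ is the number of its intersection points with a generic vertical line plus the number of its intersection points with a generic horizontal line. Let $Z\subset\mathbb{C}^2$ be an algebraic curve with no vertical component, i.e. no irreducible component of $Z$ is a vertical line. If $\deg(f^n(Z))=O(1)$ as $n\to\infty$, where $f^n(Z)$ is the image set, then $Z$ is preperiodic: there are integers $m\ge 0$ and $k\ge 1$ such that $f^{m+k}(Z)=f^m(Z)$. -/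

import Mathlib

/-- The quadratic family as a self-map of `ℂ²`, with coordinates `(z, lam)`:
`f (z, lam) = (z ^ 2 + lam, lam)`. -/
def quadFamily (p : ℂ × ℂ) : ℂ × ℂ := (p.1 ^ 2 + p.2, p.2)

/-- An algebraic curve in `ℂ²` (reduced, possibly reducible): the zero set of a nonconstant
polynomial in the two variables `z` (index `0`) and `lam` (index `1`). -/
def IsAlgebraicCurve (Z : Set (ℂ × ℂ)) : Prop :=
  ∃ P : MvPolynomial (Fin 2) ℂ, 0 < P.totalDegree ∧
    Z = {p : ℂ × ℂ | MvPolynomial.eval ![p.1, p.2] P = 0}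

/-- The vertical line `{(z, c) : z ∈ ℂ}` over the parameter `c`. -/
def verticalLine (c : ℂ) : Set (ℂ × ℂ) := {p : ℂ × ℂ | p.2 = c}

/-- The horizontal line `{(c, lam) : lam ∈ ℂ}`. -/
def horizontalLine (c : ℂ) : Set (ℂ × ℂ) := {p : ℂ × ℂ | p.1 = c}

/-- No irreducible component of the curve `Z` is a vertical line. (A line that is contained in an
algebraic curve is one of its irreducible components.) -/
def HasNoVerticalComponent (Z : Set (ℂ × ℂ)) : Prop :=
  ∀ c : ℂ, ¬ verticalLine c ⊆ Z

/-- The degree of a curve `Z` in `ℂ²`: the number of intersection points with a generic vertical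
line plus the number of intersection points with a generic horizontal line. For an algebraic curve,
each of the two numbers is finite and independent of the line for all but finitely many lines, and
the `limsup` along the cofinite filter is this generic value. -/
noncomputable def curveDegree (Z : Set (ℂ × ℂ)) : ℕ∞ :=
  Filter.limsup (fun c : ℂ => (Z ∩ verticalLine c).encard) Filter.cofinite +
    Filter.limsup (fun c : ℂ => (Z ∩ horizontalLine c).encard) Filter.cofinite

/-- If all but finitely many vertical lines meet `Z` in `a` points and all but finitely many
horizontal lines meet `Z` in `b` points, then the degree of `Z` is `a + b`. -/
theorem curveDegree_eq_of_generic {Z : Set (ℂ × ℂ)} {a b : ℕ∞}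
    (ha : ∀ᶠ c : ℂ in Filter.cofinite, (Z ∩ verticalLine c).encard = a)
    (hb : ∀ᶠ c : ℂ in Filter.cofinite, (Z ∩ horizontalLine c).encard = b) :
    curveDegree Z = a + b := by
  unfold curveDegree
  rw [Filter.limsup_congr ha, Filter.limsup_congr hb, Filter.limsup_const, Filter.limsup_const]

/-- `Z` is preperiodic under the quadratic family: `f^(m+k)(Z) = f^m(Z)` for some `m ≥ 0` and
some `k ≥ 1`. -/
def IsPreperiodicCurve (Z : Set (ℂ × ℂ)) : Prop :=
  ∃ m k : ℕ, 0 < k ∧ quadFamily^[m + k] '' Z = quadFamily^[m] '' Z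

open Polynomial

/-! The curve is studied near λ = ∞. The images of an irreducible nonvertical component are
irreducible curves `P n` of bounded bidegree. Over an algebraically closed field L containing ℂ[λ],
with a valuation making λ large and constants units, a root of `P 0` has an orbit under x ↦ x² + λ
whose n-th point is a root of `P n`.

Two facts collide. Bounded bidegree bounds the orbit, so no point escapes and each lies near one of
the two square roots ±s of -λ. The map expands by v(s) near ±s, so two times with equal long
itineraries give arbitrarily close points (`exists_close_of_bounded_orbit`). Yet the resultant of
two non-associated irreducible polynomials is a nonzero polynomial in λ, of valuation at least 1,
which keeps their roots apart by an amount depending only on the bidegree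
(`one_le_mul_valuation_sub_of_not_associated`). Hence two of the `P n` are associated and the
component is preperiodic; finite unions follow. -/

/-! ### A place over λ = ∞ -/

theorem exists_valuation_at_infinity : ∃ (L : Type) (_ : Field L) (_ : IsAlgClosed L)
    (i : ℂ[X] →+* L) (Γ : Type) (_ : LinearOrderedCommGroupWithZero Γ) (v : Valuation L Γ),
    Function.Injective i ∧ 1 < v (i X) ∧ ∀ c : ℂ, c ≠ 0 → v (i (C c)) = 1 := by
  let L := AlgebraicClosure (RatFunc ℂ)
  let i : ℂ[X] →+* L := (algebraMap (RatFunc ℂ) L).comp (algebraMap ℂ[X] (RatFunc ℂ))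
  have hi : Function.Injective i :=
    (algebraMap (RatFunc ℂ) L).injective.comp (IsFractionRing.injective ℂ[X] (RatFunc ℂ))
  have hC : ∀ c, i (C c) = algebraMap ℂ L c := fun c => by
    simp only [i, RingHom.comp_apply]
    rw [IsScalarTower.algebraMap_apply ℂ (RatFunc ℂ) L]
    simp
  -- Since λ is transcendental over ℂ, some valuation ring contains the integral closure of ℂ but
  -- not λ.
  have hX : i X ∉ (integralClosure ℂ L).toSubring := by
    intro h
    obtain ⟨p, hp, hp0⟩ : IsIntegral ℂ (i X) := h
    have : i p = 0 := by
      rw [← hp0, eval₂_eq_sum_range]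
      conv_lhs => rw [p.as_sum_range_C_mul_X_pow]
      simp [map_sum, hC]
    exact hp.ne_zero (hi (by rw [this, map_zero]))
  have : IsIntegrallyClosedIn (integralClosure ℂ L).toSubring L :=
    inferInstanceAs (IsIntegrallyClosedIn (integralClosure ℂ L) L)
  obtain ⟨V, hV, hXV⟩ := Subring.exists_le_valuationSubring_of_isIntegrallyClosedIn hX
  refine ⟨L, inferInstance, inferInstance, i, V.ValueGroup, inferInstance, V.valuation, hi, ?_, ?_⟩
  · rwa [← not_le, V.valuation_le_one_iff]
  · have hle : ∀ c : ℂ, V.valuation (i (C c)) ≤ 1 := fun c => by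
      rw [V.valuation_le_one_iff, hC]
      exact hV ((integralClosure ℂ L).algebraMap_mem c)
    intro c hc
    refine le_antisymm (hle c) ?_
    have h1 : V.valuation (i (C c)) * V.valuation (i (C c⁻¹)) = 1 := by
      rw [← map_mul, ← map_mul, ← C_mul, mul_inv_cancel₀ hc]; simp
    calc 1 = V.valuation (i (C c)) * V.valuation (i (C c⁻¹)) := h1.symm
      _ ≤ V.valuation (i (C c)) := mul_le_of_le_one_right' (hle _)

/-! ### Ultrametric estimates for polynomials -/

section

variable {L : Type*} [Field L] {Γ : Type*} [LinearOrderedCommGroupWithZero Γ] {v : Valuation L Γ}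

theorem Valuation.map_eval_eq_of_dominant {p : L[X]} {x : L}
    (h : ∀ k < p.natDegree, v (p.coeff k * x ^ k) < v (p.leadingCoeff * x ^ p.natDegree)) :
    v (p.eval x) = v (p.leadingCoeff * x ^ p.natDegree) := by
  rw [eval_eq_sum_range, Finset.sum_range_succ]
  rcases Nat.eq_zero_or_pos p.natDegree with h0 | h0
  · simp [h0, leadingCoeff]
  · have hne : v (p.leadingCoeff * x ^ p.natDegree) ≠ 0 := (lt_of_le_of_lt zero_le (h 0 h0)).ne'
    exact v.map_add_eq_of_lt_right (v.map_sum_lt hne fun k hk => h k (Finset.mem_range.1 hk))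

theorem Valuation.map_eval_le {p : L[X]} {x : L} {c b : Γ} (hb : 1 ≤ b) {D : ℕ}
    (hD : p.natDegree ≤ D) (hc : ∀ k, v (p.coeff k) ≤ c) (hx : v x ≤ b) :
    v (p.eval x) ≤ c * b ^ D := by
  rw [eval_eq_sum_range]
  refine v.map_sum_le fun k hk => ?_
  rw [map_mul, map_pow]
  exact mul_le_mul' (hc k) ((pow_le_pow_left' hx k).trans
    (pow_le_pow_right₀ hb ((Nat.lt_succ_iff.1 (Finset.mem_range.1 hk)).trans hD)))

/-- Cauchy's bound: for v x > c the leading term would strictly dominate all others. -/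
theorem Valuation.root_le {p : L[X]} (hp : p ≠ 0) {x : L} {c : Γ} (h1 : 1 ≤ c)
    (hlc : 1 ≤ v p.leadingCoeff) (hc : ∀ k, v (p.coeff k) ≤ c) (hx : p.eval x = 0) : v x ≤ c := by
  by_contra! hlt
  have hx1 : 1 ≤ v x := h1.trans hlt.le
  have hx0 : 0 < v x := zero_lt_one.trans_le hx1
  have := v.map_eval_eq_of_dominant (p := p) (x := x) fun k hk => by
    rw [map_mul, map_pow, map_mul, map_pow]
    calc v (p.coeff k) * v x ^ k ≤ c * v x ^ k := mul_le_mul_left (hc k) _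
      _ < v x * v x ^ k := mul_lt_mul_of_pos_right hlt (pow_pos hx0 k)
      _ = v x ^ (k + 1) := (pow_succ' _ _).symm
      _ ≤ v x ^ p.natDegree := pow_le_pow_right₀ hx1 hk
      _ ≤ v p.leadingCoeff * v x ^ p.natDegree := le_mul_of_one_le_left' hlc
  rw [hx, map_zero, eq_comm, map_eq_zero] at this
  have hx0' : x ≠ 0 := by rintro rfl; simp at hx0
  simp [hp, hx0'] at this

/-- Lipschitz estimate for polynomial evaluation. -/
theorem Valuation.map_eval_sub_le {p : L[X]} {x y : L} {c b : Γ} (hb : 1 ≤ b) {D : ℕ}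
    (hD : p.natDegree ≤ D) (hc : ∀ k, v (p.coeff k) ≤ c) (hx : v x ≤ b) (hy : v y ≤ b) :
    v (p.eval x - p.eval y) ≤ c * b ^ D * v (x - y) := by
  rw [eval_eq_sum_range, eval_eq_sum_range, ← Finset.sum_sub_distrib]
  refine v.map_sum_le fun k hk => ?_
  rw [← mul_sub, ← Commute.geom_sum₂_mul (Commute.all x y), map_mul, map_mul, ← mul_assoc]
  refine mul_le_mul_left (mul_le_mul' (hc k) (v.map_sum_le fun j hj => ?_)) _
  rw [map_mul, map_pow, map_pow]
  have hj := Finset.mem_range.1 hj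
  have hk := Finset.mem_range.1 hk
  calc v x ^ j * v y ^ (k - 1 - j) ≤ b ^ j * b ^ (k - 1 - j) :=
        mul_le_mul' (pow_le_pow_left' hx _) (pow_le_pow_left' hy _)
    _ = b ^ (j + (k - 1 - j)) := (pow_add _ _ _).symm
    _ ≤ b ^ D := pow_le_pow_right₀ hb (by omega)

end

theorem valuation_polynomial {L : Type*} [Field L] {Γ : Type*} [LinearOrderedCommGroupWithZero Γ]
    {v : Valuation L Γ} {i : ℂ[X] →+* L} (hX : 1 < v (i X))
    (hC : ∀ c : ℂ, c ≠ 0 → v (i (C c)) = 1) {p : ℂ[X]} (hp : p ≠ 0) :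
    v (i p) = v (i X) ^ p.natDegree := by
  have hinj : Function.Injective (i.comp C) := (i.comp C).injective
  have hev : i p = (p.map (i.comp C)).eval (i X) := by
    conv_lhs => rw [p.as_sum_range_C_mul_X_pow]
    rw [eval_map, eval₂_eq_sum_range]
    simp
  have hdeg : (p.map (i.comp C)).natDegree = p.natDegree := natDegree_map_eq_of_injective hinj p
  have hlead : v ((p.map (i.comp C)).leadingCoeff * i X ^ p.natDegree) = v (i X) ^ p.natDegree := by
    rw [leadingCoeff_map_of_injective hinj]
    simp [hC _ (leadingCoeff_ne_zero.2 hp)]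
  have := v.map_eval_eq_of_dominant (p := p.map (i.comp C)) (x := i X) fun k hk => by
    rw [hdeg] at hk ⊢
    rw [hlead, coeff_map, map_mul, map_pow]
    have : v ((i.comp C) (p.coeff k)) ≤ 1 := by
      by_cases h : p.coeff k = 0
      · simp [h]
      · exact (hC _ h).le
    calc _ ≤ v (i X) ^ k := mul_le_of_le_one_left' this
      _ < _ := pow_lt_pow_right₀ hX hk
  rw [hev, this, hdeg, hlead]

/-! ### Separation of roots by the resultant -/

/-- Non-associated irreducible polynomials of bounded bidegree have no close roots. -/
theorem one_le_mul_valuation_sub_of_not_associated {L : Type*} [Field L] [IsAlgClosed L]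
    {Γ : Type*} [LinearOrderedCommGroupWithZero Γ] {v : Valuation L Γ} {i : ℂ[X] →+* L}
    (hi : Function.Injective i) (hX : 1 < v (i X)) (hC : ∀ c : ℂ, c ≠ 0 → v (i (C c)) = 1)
    {P Q : ℂ[X][X]} (hP : Irreducible P) (hQ : Irreducible Q)
    (hQ0 : 0 < Q.natDegree) (hPQ : ¬ Associated P Q) {D : ℕ} (hPD : P.natDegree ≤ D)
    (hQD : Q.natDegree ≤ D) (hPc : ∀ k, (P.coeff k).natDegree ≤ D)
    (hQc : ∀ k, (Q.coeff k).natDegree ≤ D) {α β : L} (hα : (P.map i).eval α = 0)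
    (hβ : (Q.map i).eval β = 0) :
    1 ≤ v (i X) ^ (D * D + (D + D * D) * D + (D + D * D)) * v (α - β) := by
  set t := v (i X) with ht
  have hle : ∀ p : ℂ[X], p.natDegree ≤ D → v (i p) ≤ t ^ D := fun p hp => by
    by_cases h : p = 0
    · simp [h]
    · rw [valuation_polynomial hX hC h]; exact pow_le_pow_right₀ hX.le hp
  have hge : ∀ p : ℂ[X], p ≠ 0 → 1 ≤ v (i p) := fun p hp => by
    rw [valuation_polynomial hX hC hp]; exact one_le_pow₀ hX.le
  have htD : 1 ≤ t ^ D := one_le_pow₀ hX.le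
  have hPd : (P.map i).natDegree = P.natDegree := natDegree_map_eq_of_injective hi P
  have hQd : (Q.map i).natDegree = Q.natDegree := natDegree_map_eq_of_injective hi Q
  have hcoefP : ∀ k, v ((P.map i).coeff k) ≤ t ^ D := fun k => by
    rw [coeff_map]; exact hle _ (hPc k)
  have hcoefQ : ∀ k, v ((Q.map i).coeff k) ≤ t ^ D := fun k => by
    rw [coeff_map]; exact hle _ (hQc k)
  have hP0' : P.map i ≠ 0 := (Polynomial.map_ne_zero_iff hi).2 hP.ne_zero
  have hQ0' : Q.map i ≠ 0 := (Polynomial.map_ne_zero_iff hi).2 hQ.ne_zero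
  have hαD : v α ≤ t ^ D := v.root_le hP0' htD (by
    rw [leadingCoeff_map_of_injective hi]; exact hge _ (leadingCoeff_ne_zero.2 hP.ne_zero))
    hcoefP hα
  have hQroot : ∀ σ, (Q.map i).eval σ = 0 → v σ ≤ t ^ D := fun σ hσ => v.root_le hQ0' htD (by
    rw [leadingCoeff_map_of_injective hi]; exact hge _ (leadingCoeff_ne_zero.2 hQ.ne_zero))
    hcoefQ hσ
  -- By Gauss's lemma, a common factor over ℂ(λ) would force P and Q to be associated.
  have hr : resultant Q P ≠ 0 := by
    intro h
    have hinj := IsFractionRing.injective ℂ[X] (RatFunc ℂ)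
    have hQp := hQ.isPrimitive hQ0.ne'
    have hcop : IsCoprime (Q.map (algebraMap ℂ[X] (RatFunc ℂ)))
        (P.map (algebraMap ℂ[X] (RatFunc ℂ))) := by
      rw [((hQp.irreducible_iff_irreducible_map_fraction_map (K := RatFunc ℂ)).1
        hQ).coprime_iff_not_dvd]
      intro hd
      exact hPQ ((hQ.associated_of_dvd hP
        (hQp.dvd_of_fraction_map_dvd_fraction_map hd)).symm)
    refine resultant_ne_zero _ _ hcop ?_
    rw [natDegree_map_eq_of_injective hinj, natDegree_map_eq_of_injective hinj,
      resultant_map_map, h, map_zero]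
  -- The product formula over the roots of Q: the factor at β is small when α is close to β, and `B`
  -- bounds each other factor.
  have key : i (resultant Q P) = (Q.map i).leadingCoeff ^ P.natDegree *
      ((Q.map i).roots.map (P.map i).eval).prod := by
    rw [← resultant_eq_prod_eval _ _ P.natDegree hPd.le (IsAlgClosed.splits _), hQd,
      resultant_map_map]
  have hβm : β ∈ (Q.map i).roots := (mem_roots hQ0').2 hβ
  obtain ⟨rest, hrest⟩ := Multiset.exists_cons_of_mem hβm
  have hcard : rest.card ≤ D := by
    have := (Q.map i).card_roots'
    rw [hrest, Multiset.card_cons] at this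
    omega
  set B := t ^ (D + D * D) with hB
  have hB1 : 1 ≤ B := one_le_pow₀ hX.le
  have hBeq : t ^ D * (t ^ D) ^ D = B := by rw [hB, pow_add, pow_mul]
  have hrestB : v (rest.map (P.map i).eval).prod ≤ B ^ D := by
    have : ∀ m : Multiset L, (∀ σ ∈ m, v σ ≤ t ^ D) →
        v (m.map (P.map i).eval).prod ≤ B ^ m.card := by
      intro m
      induction m using Multiset.induction_on with
      | empty => simp
      | cons a m ih =>
        intro h
        rw [Multiset.map_cons, Multiset.prod_cons, map_mul, Multiset.card_cons, pow_succ']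
        refine mul_le_mul' ?_ (ih fun σ hσ => h σ (Multiset.mem_cons_of_mem hσ))
        rw [← hBeq]
        exact v.map_eval_le htD (hPd.trans_le hPD) hcoefP (h a (Multiset.mem_cons_self a m))
    refine (this rest fun σ hσ => hQroot σ ?_).trans (pow_le_pow_right₀ hB1 hcard)
    have : σ ∈ (Q.map i).roots := by rw [hrest]; exact Multiset.mem_cons_of_mem hσ
    exact ((mem_roots hQ0').1 this)
  have hmain : v ((P.map i).eval β) ≤ B * v (α - β) := by
    have := v.map_eval_sub_le htD (hPd.trans_le hPD) hcoefP hαD (hQroot β hβ)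
    rwa [hα, zero_sub, Valuation.map_neg, hBeq] at this
  have hlc : v ((Q.map i).leadingCoeff ^ P.natDegree) ≤ t ^ (D * D) := by
    rw [map_pow, pow_mul]
    exact (pow_le_pow_left' (hcoefQ _) _).trans (pow_le_pow_right₀ htD hPD)
  -- The three exponents come from the leading coefficient, the at most D other roots, and the
  -- Lipschitz constant at β.
  calc 1 ≤ v (i (resultant Q P)) := hge _ hr
    _ = v ((Q.map i).leadingCoeff ^ P.natDegree) *
        (v ((P.map i).eval β) * v (rest.map (P.map i).eval).prod) := by
      rw [key, hrest, Multiset.map_cons, Multiset.prod_cons, map_mul, map_mul]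
    _ ≤ t ^ (D * D) * (B * v (α - β) * B ^ D) := mul_le_mul' hlc (mul_le_mul' hmain hrestB)
    _ = _ := by rw [pow_add, pow_add, pow_mul _ (D + D * D) D, ← hB]; ac_rfl

/-! ### Recurrence of bounded orbits -/

/-- Orbits of `x ↦ x ^ 2 + a` of bounded size, over a place where `a` has a pole, are recurrent. -/
theorem exists_close_of_bounded_orbit {L : Type*} [Field L] [IsAlgClosed L]
    {Γ : Type*} [LinearOrderedCommGroupWithZero Γ] {v : Valuation L Γ} {a : L} (ha : 1 < v a)
    (h2 : v 2 = 1) {α : ℕ → L} (hα : ∀ n, α (n + 1) = α n ^ 2 + a) {D : ℕ}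
    (hD : ∀ n, v (α n) ≤ v a ^ D) (M : ℕ) : ∃ i j, i < j ∧ v a ^ M * v (α i - α j) < 1 := by
  -- Otherwise the square dominates a forever, and D + 1 squarings exceed the bound since D < 2 ^ D.
  have hsq : ∀ n, v (α n) ^ 2 ≤ v a := by
    intro n
    by_contra! hlt
    have hstep : ∀ k, v a < v (α (n + k)) ^ 2 ∧ v (α (n + k)) = v (α n) ^ 2 ^ k := by
      intro k
      induction k with
      | zero => simpa using hlt
      | succ k ih =>
        have h1 : v (α (n + (k + 1))) = v (α (n + k)) ^ 2 := by
          rw [← add_assoc, hα, v.map_add_eq_of_lt_left (by rw [map_pow]; exact ih.1), map_pow]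
        refine ⟨?_, by rw [h1, ih.2, ← pow_mul, ← pow_succ]⟩
        rw [h1]
        exact ih.1.trans_le (le_self_pow₀ (ha.trans ih.1).le two_ne_zero)
    have h := (hstep (D + 1)).2 ▸ hD (n + (D + 1))
    rw [pow_succ' 2 D, pow_mul] at h
    have h3 : v a ^ 2 ^ D < (v (α n) ^ 2) ^ 2 ^ D :=
      pow_lt_pow_left₀ hlt zero_le (by positivity)
    exact (h3.trans_le h).not_ge (pow_le_pow_right₀ ha.le Nat.lt_two_pow_self.le)
  obtain ⟨s, hs⟩ := IsAlgClosed.exists_pow_nat_eq (-a) two_pos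
  have hvs : v s ^ 2 = v a := by rw [← map_pow, hs, Valuation.map_neg]
  have hs1 : 1 < v s := by
    by_contra! h
    exact ((pow_le_one₀ zero_le h).trans_lt ha).ne hvs
  have hle : ∀ n, v (α n) ≤ v s := fun n => by
    have := hsq n
    rw [← hvs] at this
    exact (pow_le_pow_iff_left₀ zero_le zero_le two_ne_zero).1 this
  -- The product (α n - s)(α n + s) = α (n + 1) has size at most v s, while one factor has size at
  -- least v (2s) = v s; the other is then at most 1.
  have hsign : ∀ n, ∃ e : Bool, v (α n - (if e then s else -s)) ≤ 1 := by
    intro n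
    by_contra! h
    have hp := h true
    have hm := h false
    simp only [if_true, Bool.false_eq_true, if_false, sub_neg_eq_add] at hp hm
    have hprod : v (α n - s) * v (α n + s) ≤ v s := by
      rw [← map_mul]
      have : (α n - s) * (α n + s) = α (n + 1) := by rw [hα]; linear_combination -hs
      rw [this]; exact hle _
    have hmax : v s ≤ max (v (α n + s)) (v (α n - s)) := by
      have : v s = v ((α n + s) - (α n - s)) := by
        rw [show (α n + s) - (α n - s) = 2 * s by ring, map_mul, h2, one_mul]
      rw [this]; exact v.map_sub _ _
    have hs0 : 0 < v s := zero_lt_one.trans hs1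
    rcases le_max_iff.1 hmax with h' | h'
    · exact hprod.not_gt (h'.trans_lt (lt_mul_of_one_lt_left (hs0.trans_le h') hp))
    · exact hprod.not_gt (h'.trans_lt (lt_mul_of_one_lt_right (hs0.trans_le h') hm))
  choose e he using hsign
  -- Pigeonhole on itineraries of length 2M + 2: 2M steps give v a ^ M, and the two spare ones beat
  -- the final bound v s.
  obtain ⟨i, j, hij, hw⟩ := Finite.exists_ne_map_eq_of_infinite
    (fun n => (fun k : Fin (2 * M + 2) => e (n + k)))
  have hfinal : ∀ i j, (∀ k < 2 * M + 2, e (i + k) = e (j + k)) → v a ^ M * v (α i - α j) < 1 := by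
    intro i j hw
    have hcontr : ∀ k ≤ 2 * M + 2, v (α (i + k) - α (j + k)) = v (α i - α j) * v s ^ k := by
      intro k
      induction k with
      | zero => simp
      | succ k ih =>
        intro hk
        -- Both points lie within 1 of the same σ = ±s, so their sum has the size of 2σ; this is the
        -- expansion factor.
        have hsum : v (α (i + k) + α (j + k)) = v s := by
          set σ := if e (i + k) then s else -s with hσ
          have hσv : v (2 * σ) = v s := by
            rw [map_mul, h2, one_mul, hσ]; split_ifs <;> simp
          have h1 := he (i + k)
          have h1' := he (j + k)
          rw [← hw k (by omega), ← hσ] at h1'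
          rw [← hσ] at h1
          rw [show α (i + k) + α (j + k) = 2 * σ + ((α (i + k) - σ) + (α (j + k) - σ)) by ring,
            v.map_add_eq_of_lt_left, hσv]
          rw [hσv]
          exact (v.map_add_le h1 h1').trans_lt hs1
        rw [← add_assoc, ← add_assoc, hα, hα,
          show α (i + k) ^ 2 + a - (α (j + k) ^ 2 + a) =
            (α (i + k) - α (j + k)) * (α (i + k) + α (j + k)) by ring,
          map_mul, hsum, ih (by omega), pow_succ, mul_assoc]
    have hN : v (α i - α j) * v s ^ (2 * M + 2) ≤ v s := by
      rw [← hcontr _ le_rfl]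
      exact (v.map_sub _ _).trans (max_le (hle _) (hle _))
    by_contra! hge
    rw [← hvs, ← pow_mul] at hge
    have : v s ^ 2 ≤ v s := by
      calc v s ^ 2 ≤ (v s ^ (2 * M) * v (α i - α j)) * v s ^ 2 := le_mul_of_one_le_left' hge
        _ = v (α i - α j) * v s ^ (2 * M + 2) := by rw [pow_add]; ac_rfl
        _ ≤ v s := hN
    exact (lt_self_pow₀ hs1 one_lt_two).not_ge this
  have hw' : ∀ k < 2 * M + 2, e (i + k) = e (j + k) := fun k hk => congrFun hw ⟨k, hk⟩
  rcases lt_or_gt_of_ne hij with h | h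
  · exact ⟨i, j, h, hfinal i j hw'⟩
  · exact ⟨j, i, h, hfinal j i fun k hk => (hw' k hk).symm⟩

theorem exists_associated_of_bounded_bidegree {P : ℕ → ℂ[X][X]} (hP : ∀ n, Irreducible (P n))
    (hpos : ∀ n, 0 < (P n).natDegree) {D : ℕ} (hD : ∀ n, (P n).natDegree ≤ D)
    (hc : ∀ n k, ((P n).coeff k).natDegree ≤ D)
    (hdvd : ∀ n, P n ∣ (P (n + 1)).comp (X ^ 2 + C X)) : ∃ i j, i < j ∧ Associated (P i) (P j) := by
  obtain ⟨L, _, _, i, Γ, _, v, hi, hX, hC⟩ := exists_valuation_at_infinity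
  have hdeg : ∀ n, ((P n).map i).natDegree = (P n).natDegree := fun n =>
    natDegree_map_eq_of_injective hi _
  -- A branch of the initial curve over λ = ∞, whose orbit follows the image curves.
  obtain ⟨α₀, hα₀⟩ := IsAlgClosed.exists_root ((P 0).map i) (by
    exact (natDegree_pos_iff_degree_pos.1 ((hpos 0).trans_eq (hdeg 0).symm)).ne')
  let α : ℕ → L := fun n => Nat.rec α₀ (fun _ x => x ^ 2 + i X) n
  have hα : ∀ n, α (n + 1) = α n ^ 2 + i X := fun n => rfl
  have hroot : ∀ n, ((P n).map i).eval (α n) = 0 := by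
    intro n
    induction n with
    | zero => exact hα₀
    | succ n ih =>
      have := eval_dvd (x := α n) (Polynomial.map_dvd i (hdvd n))
      rw [ih, zero_dvd_iff, Polynomial.map_comp, eval_comp] at this
      simpa [hα] using this
  have hbound : ∀ n, v (α n) ≤ v (i X) ^ D := fun n => by
    refine v.root_le ((Polynomial.map_ne_zero_iff hi).2 (hP n).ne_zero) (one_le_pow₀ hX.le) ?_ ?_
      (hroot n)
    · rw [leadingCoeff_map_of_injective hi,
        valuation_polynomial hX hC (leadingCoeff_ne_zero.2 (hP n).ne_zero)]
      exact one_le_pow₀ hX.le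
    · intro k
      rw [coeff_map]
      by_cases h : (P n).coeff k = 0
      · simp [h]
      · rw [valuation_polynomial hX hC h]; exact pow_le_pow_right₀ hX.le (hc n k)
  have h2 : v 2 = 1 := by
    have := hC 2 two_ne_zero
    rwa [show (C 2 : ℂ[X]) = 2 from rfl, map_ofNat] at this
  obtain ⟨m, n, hmn, hlt⟩ := exists_close_of_bounded_orbit hX h2 hα hbound
    (D * D + (D + D * D) * D + (D + D * D))
  refine ⟨m, n, hmn, ?_⟩
  by_contra hna
  exact hlt.not_ge (one_le_mul_valuation_sub_of_not_associated hi hX hC (hP m) (hP n)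
    (hpos n) hna (hD m) (hD n) (hc m) (hc n) (hroot m) (hroot n))

/-! ### Bidegree and generic fibres -/

/-- The separable fibres of an irreducible bivariate polynomial. -/
theorem eventually_natDegree_le_encard {P : ℂ[X][X]} (hP : Irreducible P) :
    ∀ᶠ x : ℂ in Filter.cofinite, (P.natDegree : ℕ∞) ≤ {y : ℂ | P.evalEval x y = 0}.encard := by
  rcases Nat.eq_zero_or_pos P.natDegree with h0 | h0
  · simp [h0]
  have hmap := (hP.isPrimitive h0.ne').irreducible_iff_irreducible_map_fraction_map
    (K := RatFunc ℂ) |>.1 hP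
  have hinj := IsFractionRing.injective ℂ[X] (RatFunc ℂ)
  have hr : resultant P (derivative P) P.natDegree P.derivative.natDegree ≠ 0 := by
    intro h
    have h1 : resultant (P.map (algebraMap ℂ[X] (RatFunc ℂ)))
        ((derivative P).map (algebraMap ℂ[X] (RatFunc ℂ))) = 0 := by
      rw [natDegree_map_eq_of_injective hinj, natDegree_map_eq_of_injective hinj,
        resultant_map_map, h, map_zero]
    rw [← derivative_map] at h1
    exact resultant_ne_zero _ _ hmap.separable h1
  -- The Bézout identity for P and P' specializes, so the fibre is separable wherever the resultant
  -- does not vanish.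
  obtain ⟨u, w, -, -, huw⟩ := exists_mul_add_mul_eq_C_resultant P (derivative P)
    (m := P.natDegree) (n := P.derivative.natDegree) le_rfl le_rfl (Or.inl h0.ne')
  set r := resultant P (derivative P) P.natDegree P.derivative.natDegree
  have hcof : ∀ q : ℂ[X], q ≠ 0 → ∀ᶠ x : ℂ in Filter.cofinite, q.eval x ≠ 0 := fun q hq => by
    rw [Filter.eventually_cofinite]
    refine q.roots.toFinset.finite_toSet.subset fun x hx => ?_
    simpa [hq] using hx
  filter_upwards [hcof r hr, hcof P.leadingCoeff (leadingCoeff_ne_zero.2 hP.ne_zero)] with x hx hlc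
  have hdeg : (P.map (evalRingHom x)).natDegree = P.natDegree :=
    natDegree_map_of_leadingCoeff_ne_zero _ hlc
  have hne : P.map (evalRingHom x) ≠ 0 := by
    intro h; rw [h] at hdeg; simp at hdeg; omega
  have hsep : (P.map (evalRingHom x)).Separable := by
    have := congrArg (Polynomial.map (evalRingHom x)) huw
    simp only [Polynomial.map_add, Polynomial.map_mul, map_C, ← derivative_map] at this
    refine ⟨C (r.eval x)⁻¹ * u.map (evalRingHom x), C (r.eval x)⁻¹ * w.map (evalRingHom x), ?_⟩
    have h2 : (C (r.eval x)⁻¹ : ℂ[X]) * C (r.eval x) = 1 := by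
      rw [← C_mul, inv_mul_cancel₀ hx, C_1]
    rw [← h2]
    simp only [coe_evalRingHom] at this
    rw [← this]
    ring
  have hset : {y : ℂ | P.evalEval x y = 0} = ((P.map (evalRingHom x)).roots.toFinset : Set ℂ) := by
    ext y
    simp only [Set.mem_ofPred_eq, Finset.mem_coe, Multiset.mem_toFinset, mem_roots hne, IsRoot,
      eval_map, eval₂_evalRingHom]
  rw [hset, Set.encard_coe_eq_coe_finsetCard,
    Multiset.toFinset_card_of_nodup (nodup_roots hsep),
    (IsAlgClosed.splits (P.map (evalRingHom x))).natDegree_eq_card_roots.symm, hdeg]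

theorem coeff_coeff_swap (P : ℂ[X][X]) (j k : ℕ) :
    ((Bivariate.swap P).coeff j).coeff k = (P.coeff k).coeff j := by
  induction P using Polynomial.induction_on' with
  | add p q hp hq => simp [hp, hq]
  | monomial n f =>
    induction f using Polynomial.induction_on' with
    | add p q hp hq => simp only [map_add, coeff_add, hp, hq]
    | monomial m r =>
      rw [Bivariate.swap_monomial_monomial]
      simp only [coeff_monomial]
      split_ifs <;> simp_all [coeff_monomial]

theorem evalEval_swap (P : ℂ[X][X]) (x y : ℂ) :
    (Bivariate.swap P).evalEval x y = P.evalEval y x := by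
  rw [← coe_aevalAeval_eq_evalEval, ← coe_aevalAeval_eq_evalEval, Bivariate.aevalAeval_swap]

/-! ### Curves and their images -/

/-- The zero set in `ℂ²` of a polynomial in `z` (outer variable) over `ℂ[lam]`. -/
def bivariateZeros (P : ℂ[X][X]) : Set (ℂ × ℂ) := {p | P.evalEval p.2 p.1 = 0}

theorem bivariateZeros_mul (P Q : ℂ[X][X]) :
    bivariateZeros (P * Q) = bivariateZeros P ∪ bivariateZeros Q := by
  ext p
  simp [bivariateZeros]

theorem bivariateZeros_eq_empty_of_isUnit {P : ℂ[X][X]} (hP : IsUnit P) :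
    bivariateZeros P = ∅ := by
  ext p
  simpa [bivariateZeros] using (hP.map (evalEvalRingHom p.2 p.1)).ne_zero

theorem bivariateZeros_subset_of_dvd {P Q : ℂ[X][X]} (h : P ∣ Q) :
    bivariateZeros P ⊆ bivariateZeros Q := by
  obtain ⟨R, rfl⟩ := h
  rw [bivariateZeros_mul]
  exact Set.subset_union_left

theorem bivariateZeros_eq_of_associated {P Q : ℂ[X][X]} (h : Associated P Q) :
    bivariateZeros P = bivariateZeros Q :=
  (bivariateZeros_subset_of_dvd h.dvd).antisymm (bivariateZeros_subset_of_dvd h.symm.dvd)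

theorem evalEval_comp_quadratic (P : ℂ[X][X]) (x y : ℂ) :
    (P.comp (X ^ 2 + C X)).evalEval x y = P.evalEval x (y ^ 2 + x) := by
  rw [← eval₂_evalRingHom, eval₂_comp]
  simp

theorem mem_bivariateZeros_comp_quadratic {P : ℂ[X][X]} {p : ℂ × ℂ} :
    p ∈ bivariateZeros (P.comp (X ^ 2 + C X)) ↔ quadFamily p ∈ bivariateZeros P := by
  simp only [bivariateZeros, Set.mem_ofPred_eq, evalEval_comp_quadratic, quadFamily]

theorem exists_even_add_odd {R : Type*} [CommRing R] (P : R[X]) :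
    ∃ A B : R[X], P = A.comp (X ^ 2) + X * B.comp (X ^ 2) := by
  induction P using Polynomial.induction_on' with
  | add p q hp hq =>
    obtain ⟨A, B, rfl⟩ := hp
    obtain ⟨A', B', rfl⟩ := hq
    exact ⟨A + A', B + B', by rw [add_comp, add_comp]; ring⟩
  | monomial n a =>
    rcases n.even_or_odd' with ⟨k, rfl | rfl⟩
    · exact ⟨monomial k a, 0, by simp [← C_mul_X_pow_eq_monomial, pow_mul]⟩
    · exact ⟨0, monomial k a, by simp [← C_mul_X_pow_eq_monomial, pow_succ, pow_mul]; ring_nf⟩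

/-- The norm of `P` along `z ↦ z ^ 2 + lam`. -/
theorem exists_norm_comp_quadratic (P : ℂ[X][X]) :
    ∃ N : ℂ[X][X], N.comp (X ^ 2 + C X) = P * P.comp (-X) := by
  obtain ⟨A, B, rfl⟩ := exists_even_add_odd P
  -- For P = A(z²) + z B(z²), P(z)P(-z) = A(z²)² - z² B(z²)²; then z² is written as (z² + λ) - λ.
  refine ⟨(A ^ 2 - X * B ^ 2).comp (X - C X), ?_⟩
  rw [comp_assoc]
  simp only [sub_comp, X_comp, C_comp, add_sub_cancel_right, mul_comp, pow_comp, add_comp,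
    comp_assoc]
  ring_nf

theorem natDegree_comp_quadratic (P : ℂ[X][X]) :
    (P.comp (X ^ 2 + C X)).natDegree = P.natDegree * 2 := by
  rw [natDegree_comp, natDegree_X_pow_add_C]

/-- The image of an irreducible curve under the quadratic family is an irreducible curve. -/
theorem exists_irreducible_image {P : ℂ[X][X]} (hP : Irreducible P) (hpos : 0 < P.natDegree) :
    ∃ Q : ℂ[X][X], Irreducible Q ∧ 0 < Q.natDegree ∧ P ∣ Q.comp (X ^ 2 + C X) ∧
      bivariateZeros Q = quadFamily '' bivariateZeros P := by
  obtain ⟨N, hN⟩ := exists_norm_comp_quadratic P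
  have hPprime := hP.prime
  have hN0 : N ≠ 0 := by
    rintro rfl
    rw [zero_comp, eq_comm, mul_eq_zero] at hN
    rcases hN with h | h
    · exact hP.ne_zero h
    · have := congrArg natDegree h
      rw [natDegree_comp] at this
      simp at this
      omega
  have hPN : P ∣ (N.comp (X ^ 2 + C X)) := hN ▸ dvd_mul_right _ _
  obtain ⟨u, hu⟩ := UniqueFactorizationMonoid.factors_prod hN0
  -- The prime P divides the pullback of the norm N, hence that of one of its irreducible factors.
  have hexists : ∃ Q ∈ UniqueFactorizationMonoid.factors N, P ∣ Q.comp (X ^ 2 + C X) := by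
    rw [← hu, mul_comp, ← coe_compRingHom_apply, map_multiset_prod] at hPN
    rcases hPprime.dvd_or_dvd hPN with h | h
    · obtain ⟨Q, hQ, hd⟩ := hPprime.exists_mem_multiset_map_dvd h
      exact ⟨Q, hQ, hd⟩
    · refine absurd (isUnit_of_dvd_unit h ?_) hP.not_isUnit
      exact u.isUnit.map (compRingHom (X ^ 2 + C X))
  obtain ⟨Q, hQN, hPQ⟩ := hexists
  have hQ : Irreducible Q := UniqueFactorizationMonoid.irreducible_of_factor Q hQN
  have hdvd : Q ∣ N := UniqueFactorizationMonoid.dvd_of_mem_factors hQN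
  refine ⟨Q, hQ, ?_, hPQ, Set.Subset.antisymm ?_ ?_⟩
  · by_contra! h0
    have hne : Q.comp (X ^ 2 + C X) ≠ 0 := by
      obtain ⟨q, rfl⟩ := natDegree_eq_zero.1 (Nat.le_zero.1 h0)
      rw [C_comp]
      exact hQ.ne_zero
    have := natDegree_le_of_dvd hPQ hne
    rw [natDegree_comp_quadratic] at this
    omega
  -- The two preimages are (±w, l); as Q divides N, at least one lies on the zero set of P.
  · rintro ⟨a, l⟩ h
    obtain ⟨w, hw⟩ := IsAlgClosed.exists_pow_nat_eq (a - l) two_pos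
    have ha : a = w ^ 2 + l := by rw [hw]; ring
    have hmem : (w, l) ∈ bivariateZeros (P * P.comp (-X)) := by
      rw [← hN, mem_bivariateZeros_comp_quadratic, quadFamily, ← ha]
      exact bivariateZeros_subset_of_dvd hdvd h
    rw [bivariateZeros_mul] at hmem
    rcases hmem with h' | h'
    · exact ⟨(w, l), h', by simp [quadFamily, ha]⟩
    · refine ⟨(-w, l), ?_, by simp [quadFamily, ha]⟩
      simpa [bivariateZeros, evalEval, eval_comp] using h'
  · rintro _ ⟨p, hp, rfl⟩
    exact mem_bivariateZeros_comp_quadratic.1 (bivariateZeros_subset_of_dvd hPQ hp)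

theorem bivariateZeros_inter_verticalLine (P : ℂ[X][X]) (c : ℂ) :
    bivariateZeros P ∩ verticalLine c = (fun y => (y, c)) '' {y | P.evalEval c y = 0} := by
  ext ⟨z, l⟩
  simp only [bivariateZeros, verticalLine, Set.mem_inter_iff, Set.mem_ofPred_eq, Set.mem_image,
    Prod.mk.injEq]
  constructor
  · rintro ⟨h, rfl⟩; exact ⟨z, h, rfl, rfl⟩
  · rintro ⟨y, h, rfl, rfl⟩; exact ⟨h, rfl⟩

theorem bivariateZeros_inter_horizontalLine (P : ℂ[X][X]) (c : ℂ) :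
    bivariateZeros P ∩ horizontalLine c =
      (fun y => (c, y)) '' {y | (Bivariate.swap P).evalEval c y = 0} := by
  ext ⟨z, l⟩
  simp only [bivariateZeros, horizontalLine, Set.mem_inter_iff, Set.mem_ofPred_eq, Set.mem_image,
    Prod.mk.injEq, evalEval_swap]
  constructor
  · rintro ⟨h, rfl⟩; exact ⟨l, h, rfl, rfl⟩
  · rintro ⟨y, h, rfl, rfl⟩; exact ⟨h, rfl⟩

theorem le_limsup_cofinite {u : ℂ → ℕ∞} {a : ℕ∞} (h : ∀ᶠ c in Filter.cofinite, a ≤ u c) :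
    a ≤ Filter.limsup u Filter.cofinite :=
  Filter.le_limsup_of_frequently_le h.frequently

/-- The degree of an irreducible curve bounds its bidegree. -/
theorem bidegree_le_curveDegree {P : ℂ[X][X]} (hP : Irreducible P) :
    (P.natDegree : ℕ∞) + (Bivariate.swap P).natDegree ≤ curveDegree (bivariateZeros P) := by
  have hs : Irreducible (Bivariate.swap P) := (MulEquiv.irreducible_iff Bivariate.swap).2 hP
  refine add_le_add (le_limsup_cofinite ?_) (le_limsup_cofinite ?_)
  · filter_upwards [eventually_natDegree_le_encard hP] with c hc
    rwa [bivariateZeros_inter_verticalLine,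
      (Prod.mk_left_injective c).encard_image]
  · filter_upwards [eventually_natDegree_le_encard hs] with c hc
    rwa [bivariateZeros_inter_horizontalLine,
      (Prod.mk_right_injective c).encard_image]

theorem curveDegree_mono {Z W : Set (ℂ × ℂ)} (h : Z ⊆ W) : curveDegree Z ≤ curveDegree W :=
  add_le_add
    (Filter.limsup_le_limsup (.of_forall fun _ => Set.encard_le_encard (by gcongr)))
    (Filter.limsup_le_limsup (.of_forall fun _ => Set.encard_le_encard (by gcongr)))

/-! ### From irreducible components to the curve -/

theorem isPreperiodicCurve_of_irreducible {P : ℂ[X][X]} (hP : Irreducible P)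
    (hpos : 0 < P.natDegree) {D : ℕ}
    (hdeg : ∀ n, curveDegree (quadFamily^[n] '' bivariateZeros P) ≤ D) :
    IsPreperiodicCurve (bivariateZeros P) := by
  choose next hnext using fun Q : {Q : ℂ[X][X] // Irreducible Q ∧ 0 < Q.natDegree} =>
    exists_irreducible_image Q.2.1 Q.2.2
  let F : ℕ → {Q : ℂ[X][X] // Irreducible Q ∧ 0 < Q.natDegree} := fun n =>
    Nat.rec ⟨P, hP, hpos⟩ (fun _ Q => ⟨next Q, (hnext Q).1, (hnext Q).2.1⟩) n
  have hzeros : ∀ n, bivariateZeros (F n).1 = quadFamily^[n] '' bivariateZeros P := by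
    intro n
    induction n with
    | zero => simp [F]
    | succ n ih =>
      rw [Function.iterate_succ', Set.image_comp, ← ih]
      exact (hnext (F n)).2.2.2
  have hbi : ∀ n, (F n).1.natDegree ≤ D ∧ (Bivariate.swap (F n).1).natDegree ≤ D := by
    intro n
    have := (bidegree_le_curveDegree (F n).2.1).trans ((hzeros n) ▸ hdeg n)
    have : (F n).1.natDegree + (Bivariate.swap (F n).1).natDegree ≤ D := by exact_mod_cast this
    omega
  obtain ⟨i, j, hij, hass⟩ := exists_associated_of_bounded_bidegree (P := fun n => (F n).1)
    (fun n => (F n).2.1) (fun n => (F n).2.2) (fun n => (hbi n).1)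
    (fun n k => by
      rw [natDegree_le_iff_coeff_eq_zero]
      intro l hl
      rw [← coeff_coeff_swap, coeff_eq_zero_of_natDegree_lt ((hbi n).2.trans_lt hl), coeff_zero])
    (fun n => (hnext (F n)).2.2.1)
  refine ⟨i, j - i, by omega, ?_⟩
  rw [Nat.add_sub_cancel' hij.le, ← hzeros, ← hzeros]
  exact (bivariateZeros_eq_of_associated hass).symm

/-- Preperiods may grow and periods be multiplied, so two curves can share both. -/
theorem IsPreperiodicCurve.image_add_mul {Z : Set (ℂ × ℂ)} {m k : ℕ}
    (h : quadFamily^[m + k] '' Z = quadFamily^[m] '' Z) (a b : ℕ) :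
    quadFamily^[m + a + b * k] '' Z = quadFamily^[m + a] '' Z := by
  have step : ∀ a, quadFamily^[m + a + k] '' Z = quadFamily^[m + a] '' Z := fun a => by
    rw [show m + a + k = a + (m + k) by ring, add_comm m a, Function.iterate_add, Set.image_comp, h,
      ← Set.image_comp, ← Function.iterate_add]
  induction b with
  | zero => simp
  | succ b ih => 
    rw [← ih, add_assoc m a (b * k), ← step (a + b * k)]
    congr 2
    ring_nf

theorem IsPreperiodicCurve.union {Z W : Set (ℂ × ℂ)} (hZ : IsPreperiodicCurve Z)
    (hW : IsPreperiodicCurve W) : IsPreperiodicCurve (Z ∪ W) := by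
  obtain ⟨m, k, hk, h⟩ := hZ
  obtain ⟨m', k', hk', h'⟩ := hW
  refine ⟨m + m', k' * k, by positivity, ?_⟩
  rw [Set.image_union, Set.image_union, image_add_mul h, mul_comm k', add_comm m m',
    image_add_mul h']

theorem isPreperiodicCurve_bivariateZeros {P : ℂ[X][X]} (hP : P ≠ 0) {D : ℕ}
    (hvert : HasNoVerticalComponent (bivariateZeros P))
    (hdeg : ∀ n, curveDegree (quadFamily^[n] '' bivariateZeros P) ≤ D) :
    IsPreperiodicCurve (bivariateZeros P) := by
  induction P using UniqueFactorizationMonoid.induction_on_prime with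
  | h₁ => exact absurd rfl hP
  | h₂ u hu => exact ⟨0, 1, one_pos, by simp [bivariateZeros_eq_empty_of_isUnit hu]⟩
  | h₃ Q p hQ hp ih =>
    rw [bivariateZeros_mul] at hvert hdeg ⊢
    refine IsPreperiodicCurve.union (isPreperiodicCurve_of_irreducible hp.irreducible ?_ (D := D)
      fun n => (curveDegree_mono (Set.image_mono Set.subset_union_left)).trans (hdeg n))
      (ih hQ (fun c hc => hvert c (hc.trans Set.subset_union_right))
      fun n => (curveDegree_mono (Set.image_mono Set.subset_union_right)).trans (hdeg n))
    -- A prime factor free of z is a nonconstant polynomial in λ, and the vertical line over any of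
    -- its roots lies in the curve.
    by_contra! h0
    obtain ⟨q, rfl⟩ := natDegree_eq_zero.1 (Nat.le_zero.1 h0)
    have hq : q.degree ≠ 0 := fun h => hp.not_isUnit ((isUnit_iff_degree_eq_zero.2 h).map C)
    obtain ⟨c, hc⟩ := IsAlgClosed.exists_root q hq
    refine hvert c fun x hx => Or.inl ?_
    have hx : x.2 = c := hx
    simpa only [bivariateZeros, Set.mem_ofPred_eq, hx, evalEval_C] using hc.eq_zero

theorem exists_bivariateZeros_eq {P : MvPolynomial (Fin 2) ℂ} (hP : P ≠ 0) :
    ∃ Q : ℂ[X][X], Q ≠ 0 ∧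
      {p : ℂ × ℂ | MvPolynomial.eval ![p.1, p.2] P = 0} = bivariateZeros Q := by
  have heval : ∀ p : ℂ × ℂ,
      (MvPolynomial.aeval ![X, C X] P : ℂ[X][X]).evalEval p.2 p.1 =
        MvPolynomial.eval ![p.1, p.2] P := by
    clear hP
    intro p
    induction P using MvPolynomial.induction_on with
    | C a =>
      rw [MvPolynomial.aeval_C, MvPolynomial.eval_C]
      exact evalEval_CC _ _ _
    | add f g hf hg => rw [map_add, map_add, evalEval_add, hf, hg]
    | mul_X f i hf =>
      rw [map_mul, map_mul, evalEval_mul, hf]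
      congr 1
      fin_cases i <;> simp [evalEval_C]
  refine ⟨MvPolynomial.aeval ![X, C X] P, ?_, ?_⟩
  · intro h
    refine hP (MvPolynomial.funext fun x => ?_)
    have := heval (x 0, x 1)
    rw [h, evalEval_zero] at this
    rw [map_zero, this]
    congr 2
    ext k
    fin_cases k <;> rfl
  · ext p
    simp [bivariateZeros, heval]

theorem lemma4 (Z : Set (ℂ × ℂ)) (hZ : IsAlgebraicCurve Z) (hvert : HasNoVerticalComponent Z)
    (hdeg : ∃ D : ℕ, ∀ n : ℕ, curveDegree (quadFamily^[n] '' Z) ≤ (D : ℕ∞)) :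
    IsPreperiodicCurve Z := by
  obtain ⟨P, hP, rfl⟩ := hZ
  obtain ⟨D, hD⟩ := hdeg
  obtain ⟨Q, hQ, hPQ⟩ := exists_bivariateZeros_eq (P := P) (by rintro rfl; simp at hP)
  rw [hPQ] at hvert hD ⊢
  exact isPreperiodicCurve_bivariateZeros hQ hvert hD
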